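/- All graphs are finite, simple, undirected and connected. A routing $R$ in $G$ is a choice of exactly one path of $G$ for every unordered pair of distinct vertices, joining the two vertices. Two paths conflict if they share an edge; $Q(R)$ is the graph whose vertices are the paths of $R$, adjacent when they conflict; the load of an edge $e$ is the number of paths of $R$ that contain $e$. The undirected optical index is $w(G)=\min_R\chi(Q(R))$, and the edge-forwarding index $\pi(G)$ is the minimum over all routings $R$ of the maximum load of an edge. A rational number $\delta\ge 1$ is feasible if $w(G)/\pi(G)=\delta$ for some graph $G$ with at least two vertices. Let $T_{2,h}$ be the complete binary tree of height $h$. For integers $k\ge 2$ and $t\ge 1$, a $G^T_{k,t}$ is a tree with a vertex $r$ such that $G^T_{k,t}-r$ has exactly $k$ components, each of which has $t$ vertices and is joined to $r$ by exactly one edge. Then: (i) For every integer $h\ge 3$, $$\frac{w(T_{2,h})}{\pi(T_{2,h})}=1+\frac{2^{2h-2}-2^{h+1}+1}{2^{2h}-2^h};$$ in particular this number is feasible. (ii) For every odd integer $k\ge 3$ and every integer $t\ge 1$, trees $G^T_{k,t}$ exist, and every such tree satisfies $$\frac{w(G^T_{k,t})}{\pi(G^T_{k,t})}=1+\frac{t-1}{(k-1)t+1};$$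 in particular this number is feasible. (iii) For every odd integer $k\ge 3$, the feasible numbers $1+\frac{t-1}{(k-1)t+1}$ tend to $\frac{k}{k-1}$ as $t\to\infty$. -/

import Mathlib

namespace SimpleGraph

universe u

variable {V : Type u}

/-- An (all-to-all) routing in `G`: exactly one path for every unordered pair of vertices.
The path from `v` to `u` is the path from `u` to `v` traversed backwards, so that the two are the
same undirected path.  (The path from a vertex to itself is necessarily the empty one; it is never
used below, where only pairs of distinct vertices are considered.) -/
structure Routing (G : SimpleGraph V) where
  path : ∀ u v : V, G.Path u v
  symm : ∀ u v : V, path v u = (path u v).reverse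

/-- The set of edges of the path that the routing `R` assigns to the unordered pair `p`. -/
def Routing.edges {G : SimpleGraph V} (R : G.Routing) (p : Sym2 V) : Set (Sym2 V) :=
  Sym2.lift
    ⟨fun u v => {e | e ∈ (R.path u v : G.Walk u v).edges}, fun u v => by
      ext e; simp [R.symm u v]⟩ p

/-- The conflict graph `Q(R)`.  Its vertices are the paths of `R`, which are indexed by the
unordered pairs of distinct vertices of `G`; two different paths are adjacent if and only if they
have a common edge. -/
def Routing.conflictGraph {G : SimpleGraph V} (R : G.Routing) :
    SimpleGraph {p : Sym2 V // ¬ p.IsDiag} where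
  Adj p q := p ≠ q ∧ ∃ e, e ∈ R.edges p.1 ∧ e ∈ R.edges q.1
  symm := ⟨fun _ _ h => ⟨h.1.symm, h.2.imp fun _ he => ⟨he.2, he.1⟩⟩⟩
  loopless := ⟨fun _ h => h.1 rfl⟩

/-- The load of an edge `e` under the routing `R`: the number of paths of `R` through `e`. -/
noncomputable def Routing.load {G : SimpleGraph V} (R : G.Routing) (e : Sym2 V) : ℕ∞ :=
  {p : Sym2 V | ¬ p.IsDiag ∧ e ∈ R.edges p}.encard

/-- The undirected optical index `w(G)`. -/
noncomputable def opticalIndex (G : SimpleGraph V) : ℕ∞ :=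
  ⨅ R : G.Routing, R.conflictGraph.chromaticNumber

/-- The edge-forwarding index `π(G)`. -/
noncomputable def forwardingIndex (G : SimpleGraph V) : ℕ∞ :=
  ⨅ R : G.Routing, ⨆ e ∈ G.edgeSet, R.load e

/-- The ratio `w(G) / π(G)`.  For a finite connected graph with at least two vertices both indices
are positive and finite; in the remaining cases the value is not meaningful. -/
noncomputable def opticalRatio (G : SimpleGraph V) : ℚ :=
  (G.opticalIndex.toNat : ℚ) / (G.forwardingIndex.toNat : ℚ)

/-- A rational number `δ ≥ 1` is feasible if it equals `w(G) / π(G)` for some finite connected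
simple graph `G` with at least two vertices. -/
def Feasible (δ : ℚ) : Prop :=
  1 ≤ δ ∧ ∃ (V : Type) (_ : Finite V) (_ : Nontrivial V) (G : SimpleGraph V),
    G.Connected ∧ G.opticalRatio = δ

/-- The complete `m`-ary tree `T_{m,h}` of height `h`: the vertices are the words of length at most
`h` over an alphabet of `m` letters, the root is the empty word, and the children of a word are the
words obtained by appending one letter. -/
def completeTree (m h : ℕ) : SimpleGraph {w : List (Fin m) // w.length ≤ h} where
  Adj x y := (∃ i, y.1 = x.1 ++ [i]) ∨ (∃ i, x.1 = y.1 ++ [i])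
  symm := ⟨fun _ _ h => h.symm⟩
  loopless := ⟨fun x h => by simp at h⟩

/-- `G` is a tree `G^T_{k,t}` with distinguished vertex `r`: the graph `G - r` has exactly `k`
components, each of which has `t` vertices and is joined to `r` by exactly one edge. -/
structure IsGTree (G : SimpleGraph V) (r : V) (k t : ℕ) : Prop where
  isTree : G.IsTree
  card_components : Nat.card (G.induce ({r}ᶜ : Set V)).ConnectedComponent = k
  card_component : ∀ c : (G.induce ({r}ᶜ : Set V)).ConnectedComponent, Nat.card c.supp = t
  one_edge : ∀ c : (G.induce ({r}ᶜ : Set V)).ConnectedComponent,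
    ∃! v : ({r}ᶜ : Set V), v ∈ c.supp ∧ G.Adj r v

end SimpleGraph

namespace SimpleGraph

universe u

variable {V : Type u}

/-! ### Routings in acyclic graphs -/

namespace Routing

variable {G : SimpleGraph V}

/-! In a tree every pair of vertices has one path, so both indices become counting problems, and it
suffices to bound load and chromatic number for an arbitrary routing. An edge splitting off `D` has
load `|D| * |Dᶜ|`; if all branches at `r` have `t` vertices and `2 * t ≤ |V|`, the largest load
occurs on an edge at `r` (`IsTree.forwardingIndex_eq`).

Upper bounds for `w` come from `Routing.colorable_of_labelling`: classes of paths whose regions meet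
in at most one vertex can share colours. For `k` branches indexed by `ZMod k`, the branch pairs with
a given sum share `t ^ 2` colours, which also serve the paths inside branch `i`, or from it to the
root, when `i + i` is that sum. For `T_{2,h}` an explicit table on seven labels uses `5 * t ^ 2 + 4
* t` colours, where `t = 2 ^ (h - 1) - 1` is the size of a subtree rooted at depth two.

Lower bounds: a path between two branches uses two of the `k` edges at `r`, so for odd `k` a colour
serves at most `(k - 1) / 2` of the `k * (k - 1) / 2 * t ^ 2` such paths
(`Routing.le_chromaticNumber_of_odd`). In `T_{2,h}` the paths through a child of the root between
its three sides form a clique of the required size (`Routing.le_chromaticNumber_of_three`). -/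

theorem mem_edges_mk (R : G.Routing) (u v : V) (e : Sym2 V) :
    e ∈ R.edges s(u, v) ↔ e ∈ (R.path u v : G.Walk u v).edges := Iff.rfl

/-- In a connected acyclic graph there is a routing. -/
theorem nonempty_of_isTree (hG : G.IsTree) : Nonempty G.Routing := by
  classical
  have h : ∀ u v : V, Nonempty (G.Path u v) := fun u v =>
    (hG.connected.preconnected u v).elim fun w => ⟨w.toPath⟩
  exact ⟨⟨fun u v => (h u v).some, fun u v => (hG.isAcyclic.subsingleton_path _ _).elim _ _⟩⟩

/-- If `e` is the only edge that leaves `S`, every path leaving `S` uses `e`. -/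
theorem mem_edges_of_cut (R : G.Routing) {S : Set V} {e : Sym2 V}
    (hS : ∀ x ∈ S, ∀ y ∉ S, G.Adj x y → s(x, y) = e) {u v : V} (hu : u ∈ S) (hv : v ∉ S) :
    e ∈ R.edges s(u, v) := by
  obtain ⟨d, hd, h1, h2⟩ := (R.path u v : G.Walk u v).exists_boundary_dart S hu hv
  rw [mem_edges_mk, ← hS _ h1 _ h2 d.adj]
  exact List.mem_map_of_mem hd

/-- In an acyclic graph, a routing stays inside connected vertex sets. -/
theorem mem_of_mem_edges (hG : G.IsAcyclic) (R : G.Routing) {S : Set V}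
    (hS : (G.induce S).Preconnected) {u v : V} (hu : u ∈ S) (hv : v ∈ S) {e : Sym2 V}
    (he : e ∈ R.edges s(u, v)) {x : V} (hx : x ∈ e) : x ∈ S := by
  classical
  obtain ⟨w⟩ := hS ⟨u, hu⟩ ⟨v, hv⟩
  let f : G.induce S ↪g G := Embedding.induce S
  let q : G.Path u v := (w.toPath).map f.toHom f.injective
  rw [mem_edges_mk, (hG.subsingleton_path u v).elim (R.path u v) q] at he
  have hx' := Walk.mem_support_of_mem_edges he hx
  have hq : (q : G.Walk u v).support = w.toPath.1.support.map f :=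
    Walk.support_map f.toHom w.toPath.1
  rw [hq, List.mem_map] at hx'
  obtain ⟨y, -, rfl⟩ := hx'
  exact y.2

theorem mem_edgeSet_of_mem_edges (R : G.Routing) {p : Sym2 V} {e : Sym2 V} (he : e ∈ R.edges p) :
    e ∈ G.edgeSet := by
  induction p with
  | _ u v => exact Walk.edges_subset_edgeSet _ he

/-- In an acyclic graph, a path between two vertices that can be joined without `e` avoids `e`. -/
theorem notMem_edges_of_reachable (hG : G.IsAcyclic) (R : G.Routing) {u v : V} {e : Sym2 V}
    (h : (G.deleteEdges {e}).Reachable u v) : e ∉ R.edges s(u, v) := by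
  classical
  obtain ⟨w⟩ := h
  let q : G.Path u v := w.toPath.map (Hom.ofLE (deleteEdges_le {e})) (fun _ _ h => h)
  rw [mem_edges_mk, (hG.subsingleton_path u v).elim (R.path u v) q]
  intro he
  simp only [q, Path.map, Walk.edges_map, List.mem_map] at he
  obtain ⟨e', he', h⟩ := he
  replace h : e' = e := by simpa using h
  subst h
  have := Walk.edges_subset_edgeSet _ he'
  simp at this

/-- Two paths of a routing in an acyclic graph which are confined to connected vertex sets with at
most one common vertex have no common edge. -/
theorem not_conflict_of_subsingleton (hG : G.IsAcyclic) (R : G.Routing) {S T : Set V}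
    (hS : (G.induce S).Preconnected) (hT : (G.induce T).Preconnected)
    (hST : (S ∩ T).Subsingleton) {p q : Sym2 V} (hp : ∀ x ∈ p, x ∈ S) (hq : ∀ x ∈ q, x ∈ T) :
    ¬ ∃ e, e ∈ R.edges p ∧ e ∈ R.edges q := by
  rintro ⟨e, hep, heq⟩
  have hadj := R.mem_edgeSet_of_mem_edges hep
  induction p with | _ a b
  induction q with | _ c d
  induction e with | _ x y
  rw [mem_edgeSet] at hadj
  have key : ∀ z ∈ s(x, y), z ∈ S ∩ T := fun z hz =>
    ⟨R.mem_of_mem_edges hG hS (hp a (by simp)) (hp b (by simp)) hep hz,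
      R.mem_of_mem_edges hG hT (hq c (by simp)) (hq d (by simp)) heq hz⟩
  exact hadj.ne (hST (key x (by simp)) (key y (by simp)))

end Routing

/-! ### Connected vertex sets and trees given by parents -/

/-- In a connected graph, deleting one edge `s(x, y)` leaves every vertex joined to `x` or `y`. -/
theorem Connected.reachable_deleteEdges_or {G : SimpleGraph V} (hG : G.Connected) (x y v : V) :
    (G.deleteEdges {s(x, y)}).Reachable x v ∨ (G.deleteEdges {s(x, y)}).Reachable y v := by
  obtain ⟨w⟩ := hG.preconnected v x
  induction w with
  | nil => exact Or.inl (Reachable.refl _)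
  | @cons a b c hab _ ih =>
    by_cases h : s(a, b) = s(c, y)
    · rcases Sym2.eq_iff.1 h with ⟨rfl, -⟩ | ⟨rfl, -⟩
      · exact Or.inl (Reachable.refl _)
      · exact Or.inr (Reachable.refl _)
    · have hr : (G.deleteEdges {s(c, y)}).Reachable b a :=
        Adj.reachable (by
          rw [deleteEdges_adj]
          exact ⟨hab.symm, by simpa [Sym2.eq_swap] using h⟩)
      exact ih.imp (fun k => k.trans hr) (fun k => k.trans hr)

/-- If every vertex of `S` other than `p` has a neighbour in `S` of smaller depth, then `S` is
connected. -/
theorem preconnected_induce_of_depth {G : SimpleGraph V} {S : Set V} {p : V} (hp : p ∈ S)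
    (depth : V → ℕ) (h : ∀ v ∈ S, v ≠ p → ∃ u ∈ S, G.Adj v u ∧ depth u < depth v) :
    (G.induce S).Preconnected := by
  have key : ∀ n, ∀ v, ∀ hv : v ∈ S, depth v = n → (G.induce S).Reachable ⟨v, hv⟩ ⟨p, hp⟩ := by
    intro n
    induction n using Nat.strong_induction_on with
    | _ n ih =>
      intro v hv hn
      by_cases hvp : v = p
      · subst hvp; exact Reachable.refl _
      · obtain ⟨u, hu, huv, hd⟩ := h v hv hvp
        have : (G.induce S).Adj ⟨v, hv⟩ ⟨u, hu⟩ := huv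
        exact this.reachable.trans (ih _ (hn ▸ hd) u hu rfl)
  exact fun a b => (key _ a.1 a.2 rfl).trans (key _ b.1 b.2 rfl).symm

/-- A graph given by a parent function along which a depth function decreases is a tree. -/
theorem isTree_of_parent [Finite V] {G : SimpleGraph V} (r : V) (par : V → V) (depth : V → ℕ)
    (hdepth : ∀ v, v ≠ r → depth (par v) < depth v)
    (hadj : ∀ x y, G.Adj x y ↔ (y ≠ r ∧ par y = x) ∨ (x ≠ r ∧ par x = y)) : G.IsTree := by
  have hconn : G.Connected := by
    have hpre : (G.induce (Set.univ : Set V)).Preconnected :=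
      preconnected_induce_of_depth (Set.mem_univ r) depth fun v _ hv =>
        ⟨par v, Set.mem_univ _, (hadj _ _).2 (Or.inr ⟨hv, rfl⟩), hdepth v hv⟩
    refine connected_iff _ |>.2 ⟨?_, ⟨r⟩⟩
    exact (induceUnivIso G).preconnected_iff.1 hpre
  rw [isTree_iff_connected_and_card]
  refine ⟨hconn, le_antisymm ?_ hconn.card_vert_le_card_edgeSet_add_one⟩
  -- Every edge joins a non-root vertex to its parent, so there are at most `|V| - 1` edges.
  have hsurj : Function.Surjective
      (fun v : {v : V // v ≠ r} => (⟨s(v.1, par v.1), (hadj _ _).2 (Or.inr ⟨v.2, rfl⟩)⟩ :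
        G.edgeSet)) := by
    rintro ⟨e, he⟩
    induction e with | _ x y
    rcases (hadj x y).1 he with ⟨h, rfl⟩ | ⟨h, rfl⟩
    · exact ⟨⟨y, h⟩, by simp [Sym2.eq_swap]⟩
    · exact ⟨⟨x, h⟩, by simp⟩
  have h1 := Nat.card_le_card_of_surjective _ hsurj
  have h2 : Nat.card {v : V // v ≠ r} < Nat.card V :=
    Finite.card_subtype_lt (x := r) (by simp)
  exact Nat.succ_le_of_lt (h1.trans_lt h2)

/-! ### Colouring paths by the labels of their ends -/

theorem ncard_nonDiag_map_eq_diag_le [Finite V] {W : Type*} (f : V → W) (x : W) :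
    {p : Sym2 V | ¬ p.IsDiag ∧ p.map f = s(x, x)}.ncard ≤ (f ⁻¹' {x}).ncard.choose 2 := by
  classical
  have := Fintype.ofFinite V
  rw [Set.ncard_eq_toFinset_card' (f ⁻¹' {x}), ← Sym2.card_image_offDiag, ← Set.ncard_coe_finset]
  refine Set.ncard_le_ncard ?_ (Set.toFinite _)
  rintro p ⟨hp, hpx⟩
  induction p with | _ a b
  simp only [Sym2.map_mk, Sym2.eq_iff, or_self] at hpx
  simp only [Finset.coe_image, Set.mem_image, Finset.mem_coe, Finset.mem_offDiag, Set.mem_toFinset]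
  exact ⟨(a, b), ⟨hpx.1, hpx.2, by simpa using hp⟩, rfl⟩

theorem ncard_map_eq_le [Finite V] {W : Type*} (f : V → W) (x y : W) :
    {p : Sym2 V | p.map f = s(x, y)}.ncard ≤ (f ⁻¹' {x}).ncard * (f ⁻¹' {y}).ncard := by
  rw [← Set.ncard_prod]
  refine le_trans (Set.ncard_le_ncard ?_ (Set.toFinite _))
    (Set.ncard_image_le (f := fun z : V × V => s(z.1, z.2)) (Set.toFinite _))
  rintro p hp
  induction p with | _ a b
  simp only [Set.mem_ofPred_eq, Sym2.map_mk] at hp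
  rcases Sym2.eq_iff.1 hp with ⟨h1, h2⟩ | ⟨h1, h2⟩
  · exact ⟨(a, b), ⟨h1, h2⟩, rfl⟩
  · exact ⟨(b, a), ⟨h2, h1⟩, Sym2.eq_swap⟩

/-- A colouring of the paths of a tree from a labelling of its vertices.  The paths with the same
pair `p` of end labels stay in the region `reg p` and receive different colours from the groups
`grp p`; two label pairs may share a group if their regions have at most one common vertex. -/
theorem Routing.colorable_of_labelling [Finite V] {G : SimpleGraph V} (hG : G.IsAcyclic)
    (R : G.Routing) {W Γ : Type*} [Fintype Γ] (f : V → W) (size : W → ℕ)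
    (hsize : ∀ w, (f ⁻¹' {w}).ncard ≤ size w) (reg : Sym2 W → Set W)
    (hreg : ∀ p, ∀ x ∈ p, x ∈ reg p) (hconn : ∀ p, (G.induce (f ⁻¹' reg p)).Preconnected)
    (grp : Sym2 W → Finset Γ) (cap : Γ → ℕ)
    (hdiag : ∀ x, (size x).choose 2 ≤ ∑ γ ∈ grp s(x, x), cap γ)
    (hoff : ∀ x y, x ≠ y → size x * size y ≤ ∑ γ ∈ grp s(x, y), cap γ)
    (hconf : ∀ p q γ, p ≠ q → γ ∈ grp p → γ ∈ grp q →
      (f ⁻¹' reg p ∩ f ⁻¹' reg q).Subsingleton) :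
    R.conflictGraph.Colorable (∑ γ, cap γ) := by
  classical
  have := Fintype.ofFinite V
  let bin : {p : Sym2 V // ¬ p.IsDiag} → Sym2 W := fun p => p.1.map f
  have hcard : ∀ b, {p : Sym2 V | ¬ p.IsDiag ∧ p.map f = b}.ncard ≤ ∑ γ ∈ grp b, cap γ := by
    intro b
    induction b with | _ x y
    by_cases hxy : x = y
    · subst hxy
      exact (ncard_nonDiag_map_eq_diag_le f x).trans
        ((Nat.choose_le_choose 2 (hsize x)).trans (hdiag x))
    · exact (Set.ncard_le_ncard (fun p hp => hp.2) (Set.toFinite _)).trans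
        ((ncard_map_eq_le f x y).trans ((Nat.mul_le_mul (hsize x) (hsize y)).trans (hoff x y hxy)))
  have hF : ∀ b, Nonempty ({p // bin p = b} ↪
      ((grp b).sigma fun γ => (Finset.univ : Finset (Fin (cap γ))))) := by
    intro b
    refine Function.Embedding.nonempty_of_card_le ?_
    rw [Fintype.card_coe, Finset.card_sigma]
    simp only [Finset.card_univ, Fintype.card_fin]
    refine le_trans (le_of_eq ?_) (hcard b)
    rw [← Nat.card_eq_fintype_card, ← Nat.card_coe_set_eq]
    exact Nat.card_congr (Equiv.subtypeSubtypeEquivSubtypeInter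
      (fun p : Sym2 V => ¬ p.IsDiag) fun p => p.map f = b)
  -- A colour is a group together with an index below its capacity; paths with the same label pair
  -- get distinct colours by the embedding `hF`.
  let col : {p : Sym2 V // ¬ p.IsDiag} → Σ γ, Fin (cap γ) := fun p => (hF (bin p)).some ⟨p, rfl⟩
  have hinj : ∀ p q, bin p = bin q → col p = col q → p = q := by
    intro p q hb hc
    have h1 : ∀ b (hq : bin q = b), col q = (hF b).some ⟨q, hq⟩ := by
      rintro _ rfl; rfl
    have h2 := hc.trans (h1 _ hb.symm)
    have h3 := (hF (bin p)).some.injective (Subtype.ext h2)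
    exact congrArg Subtype.val h3
  have hmem : ∀ p, (col p).1 ∈ grp (bin p) := fun p =>
    (Finset.mem_sigma.1 ((hF (bin p)).some ⟨p, rfl⟩).2).1
  let C : R.conflictGraph.Coloring (Σ γ, Fin (cap γ)) := Coloring.mk col (by
    rintro p q ⟨hne, hpq⟩ hc
    have hb : bin p ≠ bin q := fun hb => hne (hinj p q hb hc)
    refine R.not_conflict_of_subsingleton hG (hconn (bin p)) (hconn (bin q))
      (hconf _ _ (col p).1 hb (hmem p) (by rw [hc]; exact hmem q)) ?_ ?_ hpq
    · exact fun x hx => hreg _ _ (Sym2.mem_map.2 ⟨x, hx, rfl⟩)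
    · exact fun x hx => hreg _ _ (Sym2.mem_map.2 ⟨x, hx, rfl⟩))
  have := C.colorable
  simpa using this

/-! ### Edge loads and the forwarding index -/

theorem ncard_image_mk_prod_compl (D : Set V) :
    ((fun z : V × V => s(z.1, z.2)) '' (D ×ˢ Dᶜ)).ncard = D.ncard * Dᶜ.ncard := by
  rw [Set.InjOn.ncard_image, Set.ncard_prod]
  rintro ⟨a, b⟩ ⟨ha, hb⟩ ⟨c, d⟩ ⟨hc, hd⟩ h
  rcases Sym2.eq_iff.1 h with ⟨h1, h2⟩ | ⟨h1, h2⟩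
  · exact Prod.ext h1 h2
  · simp only at h1 h2 ha hd
    exact absurd (h1 ▸ ha) hd

/-- The load of `e` is at most `|D| * |Dᶜ|` if all paths through `e` join `D` to its complement. -/
theorem Routing.load_le [Finite V] {G : SimpleGraph V} (R : G.Routing) {e : Sym2 V} {D : Set V}
    (h : ∀ u v, e ∈ R.edges s(u, v) → (u ∈ D ∧ v ∉ D) ∨ (v ∈ D ∧ u ∉ D)) :
    R.load e ≤ (D.ncard * Dᶜ.ncard : ℕ) := by
  rw [← ncard_image_mk_prod_compl, Set.Finite.cast_ncard_eq (Set.toFinite _), Routing.load]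
  refine Set.encard_le_encard ?_
  rintro p ⟨-, hp⟩
  induction p with | _ u v
  rcases h u v hp with ⟨h1, h2⟩ | ⟨h1, h2⟩
  · exact ⟨(u, v), ⟨h1, h2⟩, rfl⟩
  · exact ⟨(v, u), ⟨h1, h2⟩, Sym2.eq_swap⟩

/-- The load of `e` is at least `|D| * |Dᶜ|` if `e` is the only edge that leaves `D`. -/
theorem Routing.le_load [Finite V] {G : SimpleGraph V} (R : G.Routing) {e : Sym2 V} {D : Set V}
    (h : ∀ x ∈ D, ∀ y ∉ D, G.Adj x y → s(x, y) = e) :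
    (D.ncard * Dᶜ.ncard : ℕ) ≤ R.load e := by
  rw [← ncard_image_mk_prod_compl, Set.Finite.cast_ncard_eq (Set.toFinite _), Routing.load]
  refine Set.encard_le_encard ?_
  rintro _ ⟨⟨u, v⟩, ⟨hu, hv⟩, rfl⟩
  refine ⟨?_, R.mem_edges_of_cut h hu hv⟩
  rw [Sym2.mk_isDiag_iff]
  intro huv
  exact hv ((show u = v from huv) ▸ hu)

/-- Every edge `e` of a tree has a side avoiding `r` on which every function constant along the
edges outside `r` is constant. -/
theorem IsTree.exists_side {G : SimpleGraph V} (hG : G.IsTree) (R : G.Routing) {α : Type*}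
    (r : V) (f : V → α) (hadj : ∀ u v, G.Adj u v → u ≠ r → v ≠ r → f u = f v) {e : Sym2 V}
    (he : e ∈ G.edgeSet) : ∃ z, ∃ D : Set V, z ≠ r ∧ D ⊆ f ⁻¹' {f z} ∧
      ∀ u v, e ∈ R.edges s(u, v) → (u ∈ D ∧ v ∉ D) ∨ (v ∈ D ∧ u ∉ D) := by
  induction e with | _ x y
  have hbr : ¬ (G.deleteEdges {s(x, y)}).Reachable x y :=
    isBridge_iff.1 (isAcyclic_iff_forall_isBridge.1 hG.isAcyclic he)
  -- `z` is the end of the edge that the deletion separates from `r`; its component is the side `D`.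
  obtain ⟨z, z', hz, hcov⟩ : ∃ z z', ¬ (G.deleteEdges {s(x, y)}).Reachable z r ∧
      ∀ v, (G.deleteEdges {s(x, y)}).Reachable z v ∨
        (G.deleteEdges {s(x, y)}).Reachable z' v := by
    by_cases hx : (G.deleteEdges {s(x, y)}).Reachable x r
    · exact ⟨y, x, fun hy => hbr (hx.trans hy.symm),
        fun v => (hG.connected.reachable_deleteEdges_or x y v).symm⟩
    · exact ⟨x, y, hx, hG.connected.reachable_deleteEdges_or x y⟩
  refine ⟨z, {v | (G.deleteEdges {s(x, y)}).Reachable z v}, ?_, ?_, ?_⟩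
  · rintro rfl
    exact hz (Reachable.refl _)
  · rintro v ⟨w⟩
    induction w with
    | nil => rfl
    | @cons a b c hab w ih =>
      have ha : a ≠ r := by
        rintro rfl
        exact hz (Reachable.refl _)
      have hb : b ≠ r := by
        rintro rfl
        exact hz hab.reachable
      have := ih (fun h => hz (hab.reachable.trans h))
        (fun v => (hcov v).imp_left fun h => hab.symm.reachable.trans h)
      rw [Set.mem_preimage, Set.mem_singleton_iff] at this ⊢
      rw [this, hadj a b (deleteEdges_le _ hab) ha hb]
  · intro u v huv
    by_cases hu : (G.deleteEdges {s(x, y)}).Reachable z u <;>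
      by_cases hv : (G.deleteEdges {s(x, y)}).Reachable z v
    · exact absurd huv (R.notMem_edges_of_reachable hG.isAcyclic (hu.symm.trans hv))
    · exact Or.inl ⟨hu, hv⟩
    · exact Or.inr ⟨hv, hu⟩
    · exact absurd huv (R.notMem_edges_of_reachable hG.isAcyclic
        (((hcov u).resolve_left hu).symm.trans ((hcov v).resolve_left hv)))

/-- The function `x * (n - x)` increases up to `n / 2`. With `d = |D|`, `t = d + a` and `n = t + d +
b`, the difference of the two sides is `a * b`. -/
theorem mul_ncard_compl_le [Finite V] {D : Set V} {t : ℕ} (hD : D.ncard ≤ t)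
    (ht : 2 * t ≤ Nat.card V) : D.ncard * Dᶜ.ncard ≤ t * (Nat.card V - t) := by
  have h := Set.ncard_add_ncard_compl D
  obtain ⟨a, ha⟩ := Nat.exists_eq_add_of_le hD
  obtain ⟨b, hb⟩ : ∃ b, Nat.card V = t + D.ncard + b :=
    Nat.exists_eq_add_of_le (by omega)
  have h1 : Dᶜ.ncard = t + b := by omega
  have h2 : Nat.card V - t = D.ncard + b := by omega
  rw [h1, h2]
  nlinarith

/-- The edge-forwarding index of a tree whose branches at `r` all have `t` vertices, at most half
of the total number. -/
theorem IsTree.forwardingIndex_eq [Finite V] {G : SimpleGraph V} (hG : G.IsTree) {ι : Type*}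
    [Nonempty ι] (r : V) (f : V → Option ι) (t : ℕ) (hr : ∀ v, f v = none ↔ v = r)
    (hadj : ∀ u v, G.Adj u v → u ≠ r → v ≠ r → f u = f v)
    (hcard : ∀ i, (f ⁻¹' {some i}).ncard = t)
    (hone : ∀ i, ∃ v, G.Adj r v ∧ ∀ w, f w = some i → G.Adj r w → w = v)
    (ht : 2 * t ≤ Nat.card V) : G.forwardingIndex = (t * (Nat.card V - t) : ℕ) := by
  have := Routing.nonempty_of_isTree hG
  have key : ∀ R : G.Routing, ⨆ e ∈ G.edgeSet, R.load e = (t * (Nat.card V - t) : ℕ) := by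
    intro R
    apply le_antisymm
    · refine iSup₂_le fun e he => ?_
      obtain ⟨z, D, hz, hD, hsep⟩ := hG.exists_side R r f hadj he
      refine (R.load_le hsep).trans (Nat.cast_le.2 (mul_ncard_compl_le ?_ ht))
      obtain ⟨i, hi⟩ := Option.ne_none_iff_exists'.1 (fun h => hz ((hr z).1 h))
      rw [← hcard i, ← hi]
      exact Set.ncard_le_ncard hD (Set.toFinite _)
    · obtain ⟨i⟩ := ‹Nonempty ι›
      obtain ⟨v, hv, hu⟩ := hone i
      have hcut : ∀ x ∈ f ⁻¹' {some i}, ∀ y ∉ f ⁻¹' {some i}, G.Adj x y → s(x, y) = s(v, r) := by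
        intro x hx y hy hxy
        have hxr : x ≠ r := by
          rintro rfl
          have h1 := (hr x).2 rfl
          rw [Set.mem_preimage, h1] at hx
          simp at hx
        have hyr : y = r := by
          by_contra hyr
          exact hy ((hadj x y hxy hxr hyr).symm.trans hx)
        subst hyr
        rw [hu x hx hxy.symm]
      refine le_trans ?_ (le_iSup₂_of_le s(v, r) hv.symm (R.le_load hcut))
      rw [hcard i, ← Set.ncard_add_ncard_compl (f ⁻¹' {some i}), hcard i, Nat.add_sub_cancel_left]
  simp only [forwardingIndex, key, iInf_const]

/-! ### Optical index of trees with equal branches -/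

/-- Being a tree supplies a routing; over an empty family the infimum would be `⊤`. -/
theorem opticalIndex_eq {G : SimpleGraph V} (hG : G.IsTree) {N : ℕ}
    (h1 : ∀ R : G.Routing, R.conflictGraph.Colorable N)
    (h2 : ∀ R : G.Routing, N ≤ R.conflictGraph.chromaticNumber) : G.opticalIndex = N := by
  have := Routing.nonempty_of_isTree hG
  have key : ∀ R : G.Routing, R.conflictGraph.chromaticNumber = N := fun R =>
    le_antisymm (h1 R).chromaticNumber_le (h2 R)
  simp only [opticalIndex, key, iInf_const]

/-- A union of branches at `r` together with `r` is connected. -/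
theorem Connected.preconnected_induce_preimage {G : SimpleGraph V} (hG : G.Connected) {α : Type*}
    {r : V} {f : V → α} (hadj : ∀ u v, G.Adj u v → u ≠ r → v ≠ r → f u = f v) {s : Set α}
    (hs : f r ∈ s) : (G.induce (f ⁻¹' s)).Preconnected := by
  refine preconnected_induce_of_depth (p := r) hs (fun v => G.dist v r) fun v hv hvr => ?_
  obtain ⟨w, hw⟩ := (hG.preconnected v r).exists_walk_length_eq_dist
  cases w with
  | nil => exact absurd rfl hvr
  | @cons _ b _ hab w =>
    refine ⟨b, ?_, hab, ?_⟩
    · by_cases hb : b = r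
      · subst hb; exact hs
      · rw [Set.mem_preimage, ← hadj v b hab hvr hb]
        exact hv
    · have := dist_le w
      rw [Walk.length_cons] at hw
      omega

/-- The number of colours needed by paths between an odd number of classes, where two paths with a
common end class conflict. -/
theorem Routing.le_chromaticNumber_of_odd {G : SimpleGraph V} (R : G.Routing) {ι κ : Type*}
    [Fintype ι] [Fintype κ] (hodd : Odd (Fintype.card ι)) (h3 : 3 ≤ Fintype.card ι)
    (x : ι → κ → V) (hx : ∀ i a j b, x i a = x j b → i = j ∧ a = b) (e : ι → Sym2 V)
    (he : ∀ i a j b, i ≠ j → e i ∈ R.edges s(x i a, x j b)) :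
    (Fintype.card ι * Fintype.card κ ^ 2 : ℕ) ≤ R.conflictGraph.chromaticNumber := by
  classical
  rw [le_chromaticNumber_iff_coloring]
  intro m C
  -- Paths are counted with both orientations, so that each colour class is an even set on which the
  -- first class index is injective.
  let T := {p : ι × ι // p.1 ≠ p.2} × κ × κ
  have hnd : ∀ z : T, ¬ (s(x z.1.1.1 z.2.1, x z.1.1.2 z.2.2)).IsDiag := fun z h =>
    z.1.2 (hx _ _ _ _ (Sym2.mk_isDiag_iff.1 h)).1
  let P : T → {p : Sym2 V // ¬ p.IsDiag} := fun z => ⟨_, hnd z⟩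
  let swap : T → T := fun z => (⟨(z.1.1.2, z.1.1.1), z.1.2.symm⟩, z.2.2, z.2.1)
  have hPswap : ∀ z, P (swap z) = P z := fun z => Subtype.ext Sym2.eq_swap
  have hP : ∀ z z' : T, z.1.1.1 = z'.1.1.1 → P z = P z' → z = z' := by
    rintro ⟨⟨⟨i, j⟩, hij⟩, a, b⟩ ⟨⟨⟨i', j'⟩, hij'⟩, a', b'⟩ (rfl : i = i') h
    rcases Sym2.eq_iff.1 (congrArg Subtype.val h) with ⟨h1, h2⟩ | ⟨h1, h2⟩
    · obtain ⟨-, rfl⟩ := hx _ _ _ _ h1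
      obtain ⟨rfl, rfl⟩ := hx _ _ _ _ h2
      rfl
    · exact absurd (hx _ _ _ _ h1).1 hij'
  have hfib : ∀ c ∈ (Finset.univ : Finset (Fin m)),
      (Finset.univ.filter fun z => C (P z) = c).card ≤ Fintype.card ι - 1 := by
    intro c _
    have hle : (Finset.univ.filter fun z => C (P z) = c).card ≤ Fintype.card ι := by
      refine Finset.card_le_card_of_injOn (fun z : T => z.1.1.1) (fun _ _ => Finset.mem_univ _) ?_
      intro z hz z' hz' hzz
      simp only [Finset.coe_filter, Finset.mem_univ, true_and, Set.mem_ofPred_eq] at hz hz'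
      refine hP z z' hzz ?_
      by_contra hne
      refine C.valid (v := P z) (w := P z') ⟨hne, e z.1.1.1, he _ _ _ _ z.1.2, ?_⟩ (hz.trans hz'.symm)
      simp only at hzz
      rw [hzz]
      exact he _ _ _ _ z'.1.2
    have heven : Even (Finset.univ.filter fun z => C (P z) = c).card := by
      rw [← ZMod.natCast_eq_zero_iff_even, Finset.cast_card]
      -- Reversal has no fixed point, so the ones cancel in pairs modulo two.
      refine Finset.sum_involution (fun z _ => swap z) ?_ ?_ ?_ ?_
      · intro _ _; decide
      · intro z _ _ h
        exact z.1.2 (congrArg (fun z : T => z.1.1.2) h)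
      · intro z hz
        simpa [hPswap] using hz
      · intro _ _; rfl
    rcases hle.lt_or_eq with h | h
    · omega
    · rw [h] at heven
      exact absurd heven (Nat.not_even_iff_odd.2 hodd)
  have h := Finset.card_le_mul_card_image_of_maps_to (s := Finset.univ)
    (fun (z : T) _ => Finset.mem_univ (C (P z))) _ hfib
  have hT : (Finset.univ : Finset T).card =
      (Fintype.card ι * (Fintype.card ι - 1)) * (Fintype.card κ * Fintype.card κ) := by
    have h1 : Fintype.card {p : ι × ι // p.1 ≠ p.2} =
        Fintype.card ι * (Fintype.card ι - 1) := by
      rw [Fintype.card_subtype]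
      have := Finset.offDiag_card (Finset.univ : Finset ι)
      rw [Finset.card_univ] at this
      rw [Nat.mul_sub_one, ← this]
      congr 1
      ext; simp
    rw [Finset.card_univ, Fintype.card_prod, Fintype.card_prod, h1]
  rw [hT, Finset.card_univ, Fintype.card_fin] at h
  have hpos : 0 < Fintype.card ι - 1 := by omega
  refine Nat.le_of_mul_le_mul_left ?_ hpos
  calc _ = _ := by ring
    _ ≤ _ := h

section Groups

variable {A : Type*} [AddCommGroup A] [DecidableEq A]

/-- The colour groups of the paths between two branches, or between a branch and the root, when
the branches are indexed by an abelian group: pairs of branches with the same sum share the same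
colours, and these colours are also used inside the branch `i` with `i + i` equal to this sum. -/
def branchGroup (p : Sym2 (Option A)) : Finset (A × Bool) :=
  Sym2.lift ⟨fun x y => match x, y with
    | none, none => ∅
    | none, some i => {(i + i, false)}
    | some i, none => {(i + i, false)}
    | some i, some j => if i = j then {(i + i, true)} else {(i + j, true), (i + j, false)},
    fun x y => by
      rcases x with _ | i <;> rcases y with _ | j <;> simp only
      by_cases h : i = j
      · subst h; rfl
      · simp only [if_neg h, if_neg (Ne.symm h), add_comm i j]⟩ p

/-- A group and one of its branches determine the label pair: the partner is the sum minus `i`, and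
when this is `i` itself the Boolean decides between inner paths and paths to the root. Hence
distinct pairs in one group share no branch. -/
theorem eq_of_mem_branchGroup {γ : A × Bool} {i : A} {p : Sym2 (Option A)}
    (hγ : γ ∈ branchGroup p) (hi : some i ∈ p) :
    p = s(some i, if γ.1 = i + i then if γ.2 then some i else none else some (γ.1 - i)) := by
  obtain ⟨y, rfl⟩ := hi
  rcases y with _ | j
  · simp only [branchGroup, Sym2.lift_mk, Finset.mem_singleton] at hγ
    simp [hγ]
  · by_cases h : i = j
    · subst h
      simp only [branchGroup, Sym2.lift_mk, if_true, Finset.mem_singleton] at hγ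
      simp [hγ]
    · simp only [branchGroup, Sym2.lift_mk, if_neg h, Finset.mem_insert,
        Finset.mem_singleton] at hγ
      have h1 : γ.1 = i + j := by rcases hγ with rfl | rfl <;> rfl
      rw [h1, if_neg (fun hh => h (add_left_cancel hh).symm), add_sub_cancel_left]

end Groups

/-- This splits the `t ^ 2` colours of one sum: `t.choose 2` for the paths inside a branch, and `(t
+ 1).choose 2 ≥ t` for those to the root. -/
theorem choose_two_add_choose_succ_two (t : ℕ) : t.choose 2 + (t + 1).choose 2 = t ^ 2 := by
  induction t with
  | zero => rfl
  | succ n ih =>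
    have h1 := Nat.choose_succ_succ' n 1
    have h2 := Nat.choose_succ_succ' (n + 1) 1
    simp only [Nat.choose_one_right, Nat.reduceAdd] at h1 h2
    have : (n + 1) ^ 2 = n ^ 2 + 2 * n + 1 := by ring
    omega

theorem IsTree.colorable_of_branches [Finite V] {G : SimpleGraph V} (hG : G.IsTree)
    (R : G.Routing) {k t : ℕ} [NeZero k] {r : V} {f : V → Option (ZMod k)}
    (hr : ∀ v, f v = none ↔ v = r)
    (hadj : ∀ u v, G.Adj u v → u ≠ r → v ≠ r → f u = f v)
    (hcard : ∀ i, (f ⁻¹' {some i}).ncard = t) : R.conflictGraph.Colorable (k * t ^ 2) := by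
  have h := R.colorable_of_labelling hG.isAcyclic f (fun w => w.elim 1 fun _ => t) ?_
    (fun p => {w | w = none ∨ w ∈ p}) (fun p x hx => Or.inr hx)
    (fun p => hG.connected.preconnected_induce_preimage hadj (Or.inl ((hr r).2 rfl)))
    branchGroup (fun γ => if γ.2 then t.choose 2 else (t + 1).choose 2) ?_ ?_ ?_
  · have hs : ∑ γ : ZMod k × Bool, (if γ.2 then t.choose 2 else (t + 1).choose 2) = k * t ^ 2 := by
      rw [Fintype.sum_prod_type]
      simp [choose_two_add_choose_succ_two, ZMod.card]
    rwa [hs] at h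
  · rintro (_ | i)
    · have : f ⁻¹' {none} = {r} := Set.ext hr
      simp [this]
    · exact (hcard i).le
  · rintro (_ | i)
    · simp
    · simp [branchGroup]
  · have h1 : t ≤ (t + 1).choose 2 := by
      rw [Nat.choose_succ_succ' t 1, Nat.choose_one_right]
      exact Nat.le_add_right _ _
    rintro (_ | i) (_ | j) hij
    · exact absurd rfl hij
    · simpa [branchGroup] using h1
    · simpa [branchGroup] using h1
    · have hij : i ≠ j := fun h => hij (congrArg some h)
      rw [branchGroup, Sym2.lift_mk]
      simp only [if_neg hij, Option.elim]
      rw [Finset.sum_pair (by simp)]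
      simp [choose_two_add_choose_succ_two, ← sq]
  -- Regions consist of the root and the branches of the label pair, so two pairs in one group can
  -- meet only in the root.
  · intro p q γ hpq hp hq x hx y hy
    have hroot : ∀ z, z ∈ f ⁻¹' {w | w = none ∨ w ∈ p} ∩ f ⁻¹' {w | w = none ∨ w ∈ q} →
        z = r := by
      rintro z ⟨h1, h2⟩
      rw [← hr]
      by_contra hz
      obtain ⟨i, hi⟩ := Option.ne_none_iff_exists'.1 hz
      have h1 := h1.resolve_left hz
      have h2 := h2.resolve_left hz
      rw [hi] at h1 h2
      exact hpq ((eq_of_mem_branchGroup hp h1).trans (eq_of_mem_branchGroup hq h2).symm)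
    rw [hroot x hx, hroot y hy]

theorem card_eq_of_branches [Finite V] {k t : ℕ} [NeZero k] {r : V} {f : V → Option (ZMod k)}
    (hr : ∀ v, f v = none ↔ v = r) (hcard : ∀ i, (f ⁻¹' {some i}).ncard = t) :
    Nat.card V = k * t + 1 := by
  have h0 : f ⁻¹' {none} = {r} := Set.ext hr
  rw [← Nat.card_congr (Equiv.sigmaFiberEquiv f), Nat.card_sigma, Fintype.sum_option]
  have h1 : Nat.card {x // f x = none} = 1 := by
    rw [← Set.ncard_singleton r, ← h0]; rfl
  have h2 : ∀ i, Nat.card {x // f x = some i} = t := fun i => hcard i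
  simp [h1, h2, ZMod.card, add_comm]

theorem IsTree.opticalIndex_of_branches [Finite V] {G : SimpleGraph V} (hG : G.IsTree)
    {k t : ℕ} [NeZero k] (hk : Odd k) (hk3 : 3 ≤ k) {r : V} {f : V → Option (ZMod k)}
    (hr : ∀ v, f v = none ↔ v = r)
    (hadj : ∀ u v, G.Adj u v → u ≠ r → v ≠ r → f u = f v)
    (hcard : ∀ i, (f ⁻¹' {some i}).ncard = t)
    (hone : ∀ i, ∃ v, G.Adj r v ∧ ∀ w, f w = some i → G.Adj r w → w = v) :
    G.opticalIndex = (k * t ^ 2 : ℕ) := by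
  refine opticalIndex_eq hG (fun R => hG.colorable_of_branches R hr hadj hcard) fun R => ?_
  choose v hv huniq using hone
  have he : ∀ i, Nonempty (Fin t ≃ (f ⁻¹' {some i} : Set V)) := fun i =>
    ⟨(Finite.equivFinOfCardEq (hcard i)).symm⟩
  let x : ZMod k → Fin t → V := fun i a => (he i).some a
  have hfx : ∀ i a, f (x i a) = some i := fun i a => ((he i).some a).2
  have h := R.le_chromaticNumber_of_odd (by rwa [ZMod.card]) (by rwa [ZMod.card]) x ?_
    (fun i => s(v i, r)) ?_
  · simpa [ZMod.card] using h
  · intro i a j b hab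
    have hij : i = j := Option.some_injective _ (by rw [← hfx i a, ← hfx j b, hab])
    subst hij
    exact ⟨rfl, (he i).some.injective (Subtype.ext hab)⟩
  · intro i a j b hij
    refine R.mem_edges_of_cut (S := f ⁻¹' {some i}) ?_ (hfx i a) ?_
    · intro y hy z hz hyz
      have hyr : y ≠ r := by
        rintro rfl
        have h1 := (hr y).2 rfl
        rw [Set.mem_preimage, h1] at hy
        simp at hy
      have hzr : z = r := by
        by_contra hzr
        exact hz ((hadj y z hyz hyr hzr).symm.trans hy)
      subst hzr
      rw [huniq i y hy hyz.symm]
    · rw [Set.mem_preimage, hfx]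
      simpa using hij.symm

/-! ### The ratio of the trees `G^T_{k,t}` and its limit -/

/-- The components of `G - r` are matched arbitrarily with `ZMod k`; the group structure only
organises the colouring. -/
theorem IsGTree.exists_labelling {G : SimpleGraph V} {r : V} {k t : ℕ}
    [NeZero k] (h : G.IsGTree r k t) : ∃ f : V → Option (ZMod k), (∀ v, f v = none ↔ v = r) ∧
      (∀ u v, G.Adj u v → u ≠ r → v ≠ r → f u = f v) ∧
      (∀ i, (f ⁻¹' {some i}).ncard = t) ∧
      (∀ i, ∃ v, G.Adj r v ∧ ∀ w, f w = some i → G.Adj r w → w = v) := by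
  classical
  have hfin : Finite (G.induce ({r}ᶜ : Set V)).ConnectedComponent :=
    Nat.finite_of_card_ne_zero (by rw [h.card_components]; exact NeZero.ne k)
  have hcc : Nat.card (G.induce ({r}ᶜ : Set V)).ConnectedComponent = Nat.card (ZMod k) := by
    rw [h.card_components, Nat.card_zmod]
  let φ : (G.induce ({r}ᶜ : Set V)).ConnectedComponent ≃ ZMod k := (Finite.card_eq.1 hcc).some
  let f : V → Option (ZMod k) := fun v =>
    if hv : v = r then none else some (φ (connectedComponentMk _ ⟨v, hv⟩))
  have hf : ∀ v (hv : v ≠ r), f v = some (φ (connectedComponentMk _ ⟨v, hv⟩)) := fun v hv =>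
    dif_neg hv
  have hfr : f r = none := dif_pos rfl
  have hmem : ∀ i w, f w = some i ↔ ∃ hw : w ≠ r,
      (⟨w, hw⟩ : ({r}ᶜ : Set V)) ∈ (φ.symm i).supp := by
    intro i w
    by_cases hw : w = r
    · subst hw; simp [hfr]
    · simp [hf w hw, hw, ConnectedComponent.mem_supp_iff, Equiv.eq_symm_apply]
  refine ⟨f, fun v => ⟨fun hv => ?_, fun hv => hv ▸ hfr⟩, ?_, ?_, ?_⟩
  · by_contra hvr
    rw [hf v hvr] at hv
    simp at hv
  · intro u v huv hu hv
    have : (G.induce ({r}ᶜ : Set V)).Adj ⟨u, hu⟩ ⟨v, hv⟩ := huv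
    rw [hf u hu, hf v hv, ConnectedComponent.sound this.reachable]
  · intro i
    have : f ⁻¹' {some i} = Subtype.val '' (φ.symm i).supp := by
      ext w
      rw [Set.mem_preimage, Set.mem_singleton_iff, hmem]
      constructor
      · rintro ⟨hw, hw'⟩; exact ⟨_, hw', rfl⟩
      · rintro ⟨w, hw', rfl⟩; exact ⟨w.2, hw'⟩
    rw [this, Set.ncard_image_of_injective _ Subtype.val_injective]
    exact h.card_component _
  · intro i
    obtain ⟨v, ⟨-, hv⟩, hu⟩ := h.one_edge (φ.symm i)
    refine ⟨v, hv, fun w hw hrw => ?_⟩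
    obtain ⟨hw1, hw2⟩ := (hmem i w).1 hw
    exact congrArg Subtype.val (hu ⟨w, hw1⟩ ⟨hw2, hrw⟩)

theorem IsGTree.opticalRatio_eq [Finite V] {G : SimpleGraph V} {r : V} {k t : ℕ} (hk : Odd k)
    (hk3 : 3 ≤ k) (ht : 1 ≤ t) (h : G.IsGTree r k t) :
    G.opticalRatio = 1 + ((t : ℚ) - 1) / (((k : ℚ) - 1) * t + 1) := by
  have : NeZero k := ⟨by omega⟩
  obtain ⟨f, hr, hadj, hcard, hone⟩ := h.exists_labelling
  have hV := card_eq_of_branches hr hcard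
  have h2t : 2 * t ≤ Nat.card V := by
    rw [hV]; nlinarith
  rw [opticalRatio, h.isTree.opticalIndex_of_branches hk hk3 hr hadj hcard hone,
    h.isTree.forwardingIndex_eq r f t hr hadj hcard hone h2t, ENat.toNat_natCast, ENat.toNat_natCast]
  have hsub : ((Nat.card V - t : ℕ) : ℚ) = ((k : ℚ) - 1) * t + 1 := by
    rw [Nat.cast_sub (by omega), hV]; push_cast; ring
  push_cast
  rw [hsub]
  have ht0 : (0 : ℚ) < t := by exact_mod_cast ht
  have hk0 : (3 : ℚ) ≤ k := by exact_mod_cast hk3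
  -- Naming the denominator keeps it as a single factor while fractions are cleared.
  obtain ⟨d, hd⟩ : ∃ d, d = ((k : ℚ) - 1) * t + 1 := ⟨_, rfl⟩
  have hd0 : d ≠ 0 := by rw [hd]; nlinarith
  rw [← hd]
  field_simp
  rw [hd]
  ring

/-- The ratio equals `k / (k - 1) * (1 - 1 / ((k - 1) * t + 1))`. -/
theorem tendsto_ratio (k : ℕ) (hk3 : 3 ≤ k) :
    Filter.Tendsto (fun t : ℕ => 1 + ((t : ℚ) - 1) / (((k : ℚ) - 1) * t + 1))
      Filter.atTop (nhds ((k : ℚ) / ((k : ℚ) - 1))) := by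
  have hk0 : (3 : ℚ) ≤ k := by exact_mod_cast hk3
  have h1 : Filter.Tendsto (fun t : ℕ => ((k : ℚ) - 1) * t + 1) Filter.atTop Filter.atTop :=
    Filter.tendsto_atTop_add_const_right _ _
      (tendsto_natCast_atTop_atTop.const_mul_atTop (by linarith))
  have h2 := ((tendsto_inv_atTop_zero.comp h1).const_sub 1).const_mul ((k : ℚ) / ((k : ℚ) - 1))
  rw [sub_zero, mul_one] at h2
  refine h2.congr fun t => ?_
  have ht0 : (0 : ℚ) ≤ t := Nat.cast_nonneg t
  have hd : ((k : ℚ) - 1) * t + 1 ≠ 0 := by nlinarith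
  have hk1 : (k : ℚ) - 1 ≠ 0 := by linarith
  simp only [Function.comp]
  field_simp
  ring

/-! ### Existence of trees `G^T_{k,t}` -/

/-- The tree whose root `none` has `k` branches, each of them a star with `t` vertices. -/
def starOfStars (k t : ℕ) [NeZero t] : SimpleGraph (Option (Fin k × Fin t)) where
  Adj x y := (∃ i, x = none ∧ y = some (i, 0)) ∨ (∃ i, y = none ∧ x = some (i, 0)) ∨
    (∃ i a, a ≠ 0 ∧ x = some (i, 0) ∧ y = some (i, a)) ∨
    (∃ i a, a ≠ 0 ∧ y = some (i, 0) ∧ x = some (i, a))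
  symm := ⟨fun _ _ h => by
    rcases h with h | h | h | h
    exacts [Or.inr (Or.inl h), Or.inl h, Or.inr (Or.inr (Or.inr h)), Or.inr (Or.inr (Or.inl h))]⟩
  loopless := ⟨fun x h => by
    rcases h with ⟨i, rfl, h⟩ | ⟨i, rfl, h⟩ | ⟨i, a, ha, rfl, h⟩ | ⟨i, a, ha, rfl, h⟩ <;>
      simp_all⟩

theorem starOfStars_adj_none {k t : ℕ} [NeZero t] {i : Fin k} {a : Fin t} :
    (starOfStars k t).Adj none (some (i, a)) ↔ a = 0 := by
  simp [starOfStars]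

theorem starOfStars_adj_some {k t : ℕ} [NeZero t] {i j : Fin k} {a b : Fin t} :
    (starOfStars k t).Adj (some (i, a)) (some (j, b)) ↔ i = j ∧ (a = 0 ∧ b ≠ 0 ∨ a ≠ 0 ∧ b = 0) := by
  constructor
  · rintro (⟨_, h, _⟩ | ⟨_, h, _⟩ | ⟨l, c, hc, h, h'⟩ | ⟨l, c, hc, h, h'⟩)
    · simp at h
    · simp at h
    all_goals
      simp only [Option.some.injEq, Prod.mk.injEq] at h h'
      grind
  · rintro ⟨rfl, ⟨rfl, h⟩ | ⟨h, rfl⟩⟩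
    · exact Or.inr (Or.inr (Or.inl ⟨_, _, h, rfl, rfl⟩))
    · exact Or.inr (Or.inr (Or.inr ⟨_, _, h, rfl, rfl⟩))

theorem starOfStars_isTree (k t : ℕ) [NeZero t] : (starOfStars k t).IsTree := by
  refine isTree_of_parent none
    (fun v => v.elim none fun p => if p.2 = 0 then none else some (p.1, 0))
    -- Not the distance to the root: star centres get depth `1` and the leaf with index `a` gets `1
    -- + a`, which suffices for descent to the parent.
    (fun v => v.elim 0 fun p => 1 + p.2.val) ?_ ?_
  · rintro (_ | ⟨i, a⟩) h
    · exact absurd rfl h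
    · by_cases ha : a = 0
      · simp [ha]
      · simpa [ha] using Nat.pos_of_ne_zero fun h => ha (Fin.ext h)
  · intro x y
    simp only [starOfStars]
    rcases x with _ | ⟨i, a⟩ <;> rcases y with _ | ⟨j, b⟩
    all_goals simp
    all_goals grind

theorem starOfStars_isGTree (k t : ℕ) [NeZero t] : (starOfStars k t).IsGTree none k t := by
  let H := (starOfStars k t).induce ({none}ᶜ : Set (Option (Fin k × Fin t)))
  let v : Fin k → Fin t → ({none}ᶜ : Set (Option (Fin k × Fin t))) := fun i a =>
    ⟨some (i, a), by simp⟩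
  have hv : ∀ x, ∃ i a, x = v i a := by
    rintro ⟨_ | ⟨i, a⟩, h⟩
    · exact absurd rfl h
    · exact ⟨i, a, rfl⟩
  have hadj : ∀ i a j b, H.Adj (v i a) (v j b) → i = j := fun i a j b h =>
    (starOfStars_adj_some.1 h).1
  have hreach : ∀ i a, H.Reachable (v i a) (v i 0) := by
    intro i a
    by_cases ha : a = 0
    · subst ha; exact Reachable.refl _
    · have : H.Adj (v i a) (v i 0) := starOfStars_adj_some.2 ⟨rfl, Or.inr ⟨ha, rfl⟩⟩
      exact this.reachable
  -- The star index is constant along edges avoiding the root, so it separates the components.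
  let lab : ({none}ᶜ : Set (Option (Fin k × Fin t))) → Option (Fin k) := fun x => x.1.map Prod.fst
  have hlab : ∀ x y, H.Reachable x y → lab x = lab y := by
    rintro x y ⟨w⟩
    induction w with
    | nil => rfl
    | @cons a b c hab _ ih =>
      obtain ⟨i, a, rfl⟩ := hv a
      obtain ⟨j, b, rfl⟩ := hv b
      rw [← ih]
      exact congrArg some (hadj _ _ _ _ hab)
  have hmk : ∀ i a j b, H.connectedComponentMk (v i a) = H.connectedComponentMk (v j b) ↔
      i = j := by
    intro i a j b
    rw [ConnectedComponent.eq]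
    constructor
    · exact fun h => Option.some_injective _ (hlab _ _ h)
    · rintro rfl
      exact (hreach i a).trans (hreach i b).symm
  have hcomp : ∀ c : H.ConnectedComponent, ∃ i, c = H.connectedComponentMk (v i 0) := by
    intro c
    induction c using ConnectedComponent.ind with | _ x
    obtain ⟨i, a, rfl⟩ := hv x
    exact ⟨i, (hmk _ _ _ _).2 rfl⟩
  refine ⟨starOfStars_isTree k t, ?_, ?_, ?_⟩
  · have : Function.Bijective fun i => H.connectedComponentMk (v i 0) :=
      ⟨fun i j h => (hmk _ _ _ _).1 h, fun c => (hcomp c).imp fun _ h => h.symm⟩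
    rw [← Nat.card_congr (Equiv.ofBijective _ this), Nat.card_fin]
  · intro c
    obtain ⟨i, rfl⟩ := hcomp c
    have hrange : (H.connectedComponentMk (v i 0)).supp = Set.range (v i) := by
      ext x
      obtain ⟨j, a, rfl⟩ := hv x
      rw [ConnectedComponent.mem_supp_iff, hmk]
      constructor
      · rintro rfl; exact ⟨a, rfl⟩
      · rintro ⟨b, hb⟩
        simpa [v] using (congrArg Subtype.val hb.symm : some (j, a) = some (i, b)) |> fun h => by
          simpa using (Prod.ext_iff.1 (Option.some_injective _ h)).1
    have hinj : Function.Injective (v i) := fun a b h => by simpa [v] using h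
    change Nat.card (H.connectedComponentMk (v i 0)).supp = t
    rw [hrange, ← Nat.card_congr (Equiv.ofInjective _ hinj), Nat.card_fin]
  · intro c
    obtain ⟨i, rfl⟩ := hcomp c
    refine ⟨v i 0, ⟨rfl, starOfStars_adj_none.2 rfl⟩, ?_⟩
    rintro x ⟨hx, hx'⟩
    obtain ⟨j, a, rfl⟩ := hv x
    obtain rfl := starOfStars_adj_none.1 hx'
    obtain rfl := (hmk _ _ _ _).1 hx
    rfl

/-! ### A clique of conflicting paths -/

/-- Paths between three disjoint sets, each of which is left by one edge only, pairwise conflict. -/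
theorem Routing.le_chromaticNumber_of_three [Finite V] {G : SimpleGraph V} (R : G.Routing)
    (S : Fin 3 → Set V) (hS : ∀ i j v, v ∈ S i → v ∈ S j → i = j) (e : Fin 3 → Sym2 V)
    (he : ∀ i, ∀ x ∈ S i, ∀ y ∉ S i, G.Adj x y → s(x, y) = e i) :
    ((S 0).ncard * (S 1).ncard + ((S 0).ncard + (S 1).ncard) * (S 2).ncard : ℕ) ≤
      R.conflictGraph.chromaticNumber := by
  let I : Set (V × V) := {z | ∃ i j, i < j ∧ z.1 ∈ S i ∧ z.2 ∈ S j}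
  have hnd : ∀ z : I, ¬ (s(z.1.1, z.1.2)).IsDiag := by
    rintro ⟨⟨u, v⟩, i, j, hij, hu, hv⟩ h
    obtain rfl : u = v := Sym2.mk_isDiag_iff.1 h
    exact hij.ne (hS _ _ _ hu hv)
  refine le_chromaticNumber_of_pairwise_adj (ι := I) ?_ (fun z => ⟨s(z.1.1, z.1.2), hnd z⟩) ?_
  · have hd : ∀ i j, i ≠ j → Disjoint (S i) (S j) := fun i j hij =>
      Set.disjoint_left.2 fun v h1 h2 => hij (hS _ _ _ h1 h2)
    have hsub : S 0 ×ˢ S 1 ∪ (S 0 ∪ S 1) ×ˢ S 2 ⊆ I := by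
      rintro ⟨u, v⟩ (⟨hu, hv⟩ | ⟨hu | hu, hv⟩)
      · exact ⟨0, 1, by decide, hu, hv⟩
      · exact ⟨0, 2, by decide, hu, hv⟩
      · exact ⟨1, 2, by decide, hu, hv⟩
    have h := Set.ncard_le_ncard hsub (Set.toFinite _)
    rw [Set.ncard_union_eq (Set.disjoint_prod.2 (Or.inr (hd 1 2 (by decide)))) (Set.toFinite _)
      (Set.toFinite _), Set.ncard_prod, Set.ncard_prod,
      Set.ncard_union_eq (hd 0 1 (by decide)) (Set.toFinite _) (Set.toFinite _)] at h
    exact h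
  · rintro ⟨⟨u, v⟩, i, j, hij, hu, hv⟩ ⟨⟨u', v'⟩, i', j', hij', hu', hv'⟩ hne
    simp only at hu hv hu' hv'
    refine ⟨fun h => hne ?_, ?_⟩
    · rcases Sym2.eq_iff.1 (congrArg Subtype.val h) with ⟨h1, h2⟩ | ⟨h1, h2⟩
      · exact Subtype.ext (Prod.ext h1 h2)
      · simp only at h1 h2
        subst h1 h2
        have h3 := hS _ _ _ hu hv'
        have h4 := hS _ _ _ hv hu'
        subst h3 h4
        exact absurd hij hij'.asymm
    · have key : ∀ u v : V, ∀ i j, i ≠ j → u ∈ S i → v ∈ S j →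
          e i ∈ R.edges s(u, v) ∧ e j ∈ R.edges s(u, v) := fun u v i j hij hu hv => by
        refine ⟨R.mem_edges_of_cut (he i) hu fun h => hij (hS _ _ _ h hv), ?_⟩
        rw [Sym2.eq_swap]
        exact R.mem_edges_of_cut (he j) hv fun h => hij (hS _ _ _ hu h)
      have h1 := key u v i j hij.ne hu hv
      have h2 := key u' v' i' j' hij'.ne hu' hv'
      -- Two two-element subsets of a three-element set meet, so the two paths share an exit edge.
      have h3 : ∀ i j i' j' : Fin 3, i < j → i' < j' → i = i' ∨ i = j' ∨ j = i' ∨ j = j' := by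
        decide
      rcases h3 i j i' j' hij hij' with rfl | rfl | rfl | rfl
      exacts [⟨_, h1.1, h2.1⟩, ⟨_, h1.1, h2.2⟩, ⟨_, h1.2, h2.1⟩, ⟨_, h1.2, h2.2⟩]

/-! ### The colouring scheme for binary trees -/

/-- The parent map of the binary tree of height two, with its vertices numbered level by level:
`0` is the root, `1`, `2` its children, `3`, `4` those of `1`, and `5`, `6` those of `2`. -/
def heapParent : Fin 7 → Fin 7 := ![0, 0, 0, 1, 1, 2, 2]

/-- `z` is `x` or an ancestor of `x`. -/
def heapAnc (z x : Fin 7) : Bool := x == z || heapParent x == z || heapParent (heapParent x) == z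

/-- `z` is on the path from `x` to `y`, or `z` is the parent of the leaf `x = y`. -/
def heapBetween (x y z : Fin 7) : Bool :=
  (heapAnc z x || heapAnc z y) &&
    (z != 0 || !(heapAnc 1 x && heapAnc 1 y || heapAnc 2 x && heapAnc 2 y))

/-- The colour groups of the paths whose end labels are `x ≤ y`. -/
def heapGroup (x y : Fin 7) : Finset (Fin 12) :=
  match x.val, y.val with
  | 3, 5 => {0} | 3, 6 => {1} | 4, 5 => {2} | 4, 6 => {3}
  | 3, 3 => {2} | 1, 3 => {3} | 4, 4 => {0} | 1, 4 => {1}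
  | 5, 5 => {1} | 2, 5 => {3} | 6, 6 => {0} | 2, 6 => {2}
  | 3, 4 => {4, 5, 10, 11} | 5, 6 => {6, 7, 10, 11}
  | 1, 5 => {4} | 1, 6 => {5} | 2, 3 => {6} | 2, 4 => {7}
  | 0, 3 => {8} | 0, 4 => {9} | 0, 5 => {8} | 0, 6 => {9}
  | 1, 2 => {10} | 0, 1 => {11} | 0, 2 => {11}
  | _, _ => ∅

/-- The bound `w ≤ 2` matters: these labels will belong to one vertex each, so a common label is a
common vertex, whereas labels `3` to `6` stand for whole subtrees. -/
theorem heapGroup_conflict : ∀ a b c d : Fin 7, a ≤ b → c ≤ d → (a = c → b ≠ d) →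
    ∀ γ ∈ heapGroup a b, γ ∈ heapGroup c d →
      ∃ w ≤ 2, ∀ z, heapBetween a b z → heapBetween c d z → z = w := by
  decide +kernel

/-- This gives connectedness of the regions: climbing to parents stays inside until the single
vertex labelled `p`. It is why the region of a leaf label includes its parent. -/
theorem heapBetween_top : ∀ a b : Fin 7, a ≤ b → ∃ p ≤ 2, heapBetween a b p ∧
    ∀ z, heapBetween a b z → z ≠ p → z ≠ 0 ∧ heapBetween a b (heapParent z) := by
  decide +kernel

theorem heapGroup_diag : ∀ a : Fin 7, a ≤ 2 ∨ ∃ γ ∈ heapGroup a a, γ < 4 := by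
  decide +kernel

/-- The cases follow the required numbers `1`, `t` and `t ^ 2`. The sibling pairs `3, 4` and `5, 6`
have no full group and assemble `t + t + 1 + (t ^ 2 - 2 * t - 1)` colours. -/
theorem heapGroup_offDiag : ∀ a b : Fin 7, a < b →
    (b ≤ 2 ∧ (heapGroup a b).Nonempty) ∨ (a ≤ 2 ∧ 3 ≤ b ∧ ∃ γ ∈ heapGroup a b, γ < 10) ∨
      (3 ≤ a ∧ ∃ γ ∈ heapGroup a b, γ < 4) ∨
      (3 ≤ a ∧ (heapGroup a b = {4, 5, 10, 11} ∨ heapGroup a b = {6, 7, 10, 11})) := by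
  decide +kernel

theorem heapBetween_ends : ∀ a b : Fin 7, heapBetween a b a ∧ heapBetween a b b := by
  decide +kernel

/-- The number of colours in each group. -/
def heapCap (t : ℕ) (γ : Fin 12) : ℕ :=
  if γ < 4 then t ^ 2 else if γ < 10 then t else if γ = 10 then 1 else t ^ 2 - 2 * t - 1

/-- The number of vertices with a given label. -/
def heapSize (t : ℕ) (x : Fin 7) : ℕ := if x ≤ 2 then 1 else t

/-- The total is `4 * t ^ 2 + 6 * t + 1 + (t ^ 2 - 2 * t - 1)`; `3 ≤ t` keeps the natural
subtraction from truncating. -/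
theorem sum_heapCap {t : ℕ} (ht : 3 ≤ t) : ∑ γ, heapCap t γ = 5 * t ^ 2 + 4 * t := by
  have : 2 * t + 1 ≤ t ^ 2 := by nlinarith
  simp [heapCap, Fin.sum_univ_succ]
  omega

theorem Routing.colorable_of_heap [Finite V] {G : SimpleGraph V} (hG : G.IsAcyclic)
    (R : G.Routing) {t : ℕ} (ht : 3 ≤ t) {f : V → Fin 7}
    (hsize : ∀ x, (f ⁻¹' {x}).ncard ≤ heapSize t x)
    (hinj : ∀ u v, f u = f v → f u ≤ 2 → u = v) (hsurj : ∀ x, ∃ v, f v = x)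
    (depth : V → ℕ)
    (hpar : ∀ v, f v ≠ 0 → ∃ u, G.Adj v u ∧ depth u < depth v ∧
      (f u = heapParent (f v) ∨ f u = f v)) :
    R.conflictGraph.Colorable (5 * t ^ 2 + 4 * t) := by
  -- Strictness leaves a colour in group `11`, which the paths from the root to its two children
  -- need.
  have hsq : 2 * t + 1 < t ^ 2 := by nlinarith
  have hp : ∀ p : Sym2 (Fin 7), p = s(p.inf, p.sup) := by
    intro p
    induction p with | _ x y
    rcases le_total x y with h | h
    · simp [h]
    · simp [h, Sym2.eq_swap]
  rw [← sum_heapCap ht]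
  refine R.colorable_of_labelling hG f (heapSize t) hsize
    (fun p => {z | heapBetween p.inf p.sup z}) ?_ ?_ (fun p => heapGroup p.inf p.sup) (heapCap t)
    ?_ ?_ ?_
  · intro p x hx
    rw [hp p, Sym2.mem_iff] at hx
    rcases hx with h | h
    · rw [h]; exact (heapBetween_ends _ _).1
    · rw [h]; exact (heapBetween_ends _ _).2
  · intro p
    obtain ⟨z, hz2, hz, hdown⟩ := heapBetween_top p.inf p.sup p.inf_le_sup
    obtain ⟨r, rfl⟩ := hsurj z
    refine preconnected_induce_of_depth (p := r) hz depth fun v hv hvr => ?_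
    obtain ⟨h0, h1⟩ := hdown (f v) hv fun h => hvr (hinj r v h.symm hz2).symm
    obtain ⟨u, hu, hd, h | h⟩ := hpar v h0
    · exact ⟨u, by rw [Set.mem_preimage, h]; exact h1, hu, hd⟩
    · exact ⟨u, by rw [Set.mem_preimage, h]; exact hv, hu, hd⟩
  · intro x
    simp only [Sym2.inf_mk, Sym2.sup_mk, inf_idem, sup_idem]
    rcases heapGroup_diag x with h | ⟨γ, hγ, h4⟩
    · simp [heapSize, h]
    · refine le_trans ?_ (Finset.single_le_sum (fun _ _ => Nat.zero_le _) hγ)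
      have h1 : heapSize t x ≤ t := by unfold heapSize; split_ifs <;> omega
      rw [heapCap, if_pos h4]
      exact (Nat.choose_le_choose 2 h1).trans
        (le_of_le_of_eq (Nat.le_add_right _ _) (choose_two_add_choose_succ_two t))
  · have key : ∀ x y : Fin 7, x < y →
        heapSize t x * heapSize t y ≤ ∑ γ ∈ heapGroup x y, heapCap t γ := by
      intro x y hxy
      have hle : ∀ γ ∈ heapGroup x y, heapCap t γ ≤ ∑ γ ∈ heapGroup x y, heapCap t γ :=
        fun γ hγ => Finset.single_le_sum (fun _ _ => Nat.zero_le _) hγ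
      rcases heapGroup_offDiag x y hxy with ⟨h, γ, hγ⟩ | ⟨h, h', γ, hγ, hc⟩ | ⟨h, γ, hγ, hc⟩ | ⟨h, hc⟩
      · refine le_trans ?_ (hle γ hγ)
        rw [heapSize, heapSize, if_pos h, if_pos (hxy.le.trans h), heapCap]
        split_ifs <;> omega
      · refine le_trans ?_ (hle γ hγ)
        rw [heapSize, heapSize, if_pos h, if_neg (by omega), heapCap, if_pos hc]
        split_ifs <;> omega
      · refine le_trans ?_ (hle γ hγ)
        rw [heapSize, heapSize, if_neg (by omega), if_neg (by omega), heapCap, if_pos hc, sq]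
      · rw [heapSize, heapSize, if_neg (by omega), if_neg (by omega), ← sq]
        rcases hc with hc | hc <;> rw [hc] <;> simp [heapCap] <;> omega
    intro x y hxy
    rcases hxy.lt_or_gt with h | h
    · simpa [h.le] using key x y h
    · simpa [h.le, mul_comm] using key y x h
  · intro p q γ hpq hγp hγq x hx y hy
    obtain ⟨w, hw2, hw⟩ := heapGroup_conflict _ _ _ _ p.inf_le_sup q.inf_le_sup
      (fun h1 h2 => hpq (by rw [hp p, hp q, h1, h2])) γ hγp hγq
    have h1 := hw _ hx.1 hx.2
    have h2 := hw _ hy.1 hy.2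
    exact hinj x y (h1.trans h2.symm) (h1 ▸ hw2)

/-! ### Complete binary trees as trees of words -/

/-- The words of length at most `h` over an alphabet with `m` letters. -/
abbrev Word (m h : ℕ) : Type := {w : List (Fin m) // w.length ≤ h}

instance (m h : ℕ) : Finite (Word m h) := by
  have : Function.Injective (fun w : Word m h =>
      (⟨⟨w.1.length, Nat.lt_succ_of_le w.2⟩, w.1, rfl⟩ :
        Σ i : Fin (h + 1), List.Vector (Fin m) i)) := by
    rintro ⟨w, hw⟩ ⟨w', hw'⟩ h
    have h1 := congrArg (fun x : Σ i : Fin (_ + 1), List.Vector (Fin m) i => x.2.1) h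
    exact Subtype.ext h1
  exact Finite.of_injective _ this

theorem card_word_two (h : ℕ) : Nat.card (Word 2 h) = 2 ^ (h + 1) - 1 := by
  have e : Word 2 h ≃ Σ i : Fin (h + 1), List.Vector (Fin 2) i :=
    { toFun := fun w => ⟨⟨w.1.length, Nat.lt_succ_of_le w.2⟩, w.1, rfl⟩
      invFun := fun x => ⟨x.2.1, by rw [x.2.2]; exact Nat.le_of_lt_succ x.1.2⟩
      left_inv := fun w => rfl
      right_inv := by
        rintro ⟨⟨i, hi⟩, w, hw⟩
        simp only at hw
        subst hw
        rfl }
  rw [Nat.card_congr e, Nat.card_sigma]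
  have : ∀ i : Fin (h + 1), Nat.card (List.Vector (Fin 2) i) = 2 ^ (i : ℕ) := fun i => by
    rw [Nat.card_eq_fintype_card, card_vector, Fintype.card_fin]
  simp only [this]
  rw [Fin.sum_univ_eq_sum_range (fun i => 2 ^ i), Nat.geomSum_eq le_rfl]
  simp

/-- The words with a given prefix. -/
def prefixSet {m h : ℕ} (p : List (Fin m)) : Set (Word m h) := {w | p <+: w.1}

theorem ncard_prefixSet {n : ℕ} (p : List (Fin 2)) :
    (prefixSet p : Set (Word 2 (n + p.length))).ncard = 2 ^ (n + 1) - 1 := by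
  let g : Word 2 n → Word 2 (n + p.length) := fun w =>
    ⟨p ++ w.1, by rw [List.length_append]; have := w.2; omega⟩
  have hg : Function.Injective g := fun a b hab =>
    Subtype.ext (List.append_cancel_left (congrArg Subtype.val hab))
  have : prefixSet p = Set.range g := by
    ext w
    constructor
    · rintro ⟨l, hl⟩
      have hw := w.2
      rw [← hl, List.length_append] at hw
      exact ⟨⟨l, by omega⟩, Subtype.ext hl⟩
    · rintro ⟨l, rfl⟩
      exact ⟨l.1, rfl⟩
  rw [this, ← Nat.card_coe_set_eq, ← Nat.card_congr (Equiv.ofInjective g hg), card_word_two]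

/-- The only edge that leaves a subtree is the one from its top vertex to the parent of this. -/
theorem completeTree_cut {m h : ℕ} {p : List (Fin m)} {x y : Word m h} (hx : x ∈ prefixSet p)
    (hy : y ∉ prefixSet p) (hxy : (completeTree m h).Adj x y) :
    x.1 = p ∧ y.1 = p.dropLast := by
  rcases hxy with ⟨i, hi⟩ | ⟨i, hi⟩
  · refine absurd ?_ hy
    change p <+: y.1
    rw [hi]
    exact List.IsPrefix.trans hx (List.prefix_append _ _)
  · have h1 : p <+: y.1 ++ [i] := hi ▸ hx
    rcases List.prefix_concat_iff.1 h1 with h2 | h2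
    · rw [hi, h2]; simp
    · exact absurd h2 hy

/-- The parent of a word. -/
def wordParent {m h : ℕ} (w : Word m h) : Word m h :=
  ⟨w.1.dropLast, by rw [List.length_dropLast]; have := w.2; omega⟩

theorem length_wordParent_lt {m h : ℕ} {w : Word m h} (hw : w.1 ≠ []) :
    (wordParent w).1.length < w.1.length := by
  have := List.length_pos_of_ne_nil hw
  rw [wordParent, List.length_dropLast]
  omega

theorem completeTree_adj_iff {m h : ℕ} (x y : Word m h) :
    (completeTree m h).Adj x y ↔ (y.1 ≠ [] ∧ wordParent y = x) ∨ (x.1 ≠ [] ∧ wordParent x = y) := by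
  have key : ∀ x y : Word m h, (∃ i, y.1 = x.1 ++ [i]) ↔ y.1 ≠ [] ∧ wordParent y = x := by
    intro x y
    constructor
    · rintro ⟨i, hi⟩
      exact ⟨by simp [hi], Subtype.ext (by simp [wordParent, hi])⟩
    · rintro ⟨h, rfl⟩
      exact ⟨y.1.getLast h, (List.dropLast_append_getLast h).symm⟩
  exact or_congr (key x y) (key y x)

theorem completeTree_isTree (m h : ℕ) : (completeTree m h).IsTree := by
  have hne : ∀ v : Word m h, v ≠ ⟨[], Nat.zero_le _⟩ ↔ v.1 ≠ [] := fun v =>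
    not_congr Subtype.ext_iff
  refine isTree_of_parent ⟨[], Nat.zero_le _⟩ wordParent (fun w => w.1.length) ?_ ?_
  · exact fun v hv => length_wordParent_lt ((hne v).1 hv)
  · intro x y
    rw [completeTree_adj_iff, hne, hne]

/-- The label of a word: the number of its longest prefix of length at most two. -/
def wordLabel : List (Fin 2) → Fin 7
  | [] => 0
  | [x] => if x = 0 then 1 else 2
  | x :: y :: _ => if x = 0 then if y = 0 then 3 else 4 else if y = 0 then 5 else 6

theorem wordLabel_dropLast : ∀ w : List (Fin 2), wordLabel w ≠ 0 →
    wordLabel w.dropLast = heapParent (wordLabel w) ∨ wordLabel w.dropLast = wordLabel w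
  | [], h => absurd rfl h
  | [x], _ => by
    left
    revert x
    decide
  | [x, y], _ => by
    left
    revert x y
    decide
  | x :: y :: z :: l, _ => Or.inr rfl

theorem wordLabel_le_two : ∀ w : List (Fin 2), wordLabel w ≤ 2 → w = [] ∨ w = [0] ∨ w = [1]
  | [], _ => Or.inl rfl
  | [x], _ => by
    revert x
    decide
  | x :: y :: l, h => by
    exfalso
    revert h
    change ¬ (if x = 0 then if y = 0 then (3 : Fin 7) else 4 else if y = 0 then 5 else 6) ≤ 2
    revert x y
    decide

theorem wordLabel_eq_iff (w : List (Fin 2)) : (wordLabel w = 3 ↔ [0, 0] <+: w) ∧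
    (wordLabel w = 4 ↔ [0, 1] <+: w) ∧ (wordLabel w = 5 ↔ [1, 0] <+: w) ∧
    (wordLabel w = 6 ↔ [1, 1] <+: w) := by
  rcases w with _ | ⟨x, _ | ⟨y, l⟩⟩
  · simp [wordLabel]
  · simp [wordLabel]
    revert x; decide
  · simp [wordLabel]
    revert x y; decide

theorem wordLabel_injOn {u v : List (Fin 2)} (h : wordLabel u = wordLabel v)
    (hu : wordLabel u ≤ 2) : u = v := by
  rcases wordLabel_le_two u hu with rfl | rfl | rfl <;>
    rcases wordLabel_le_two v (h ▸ hu) with rfl | rfl | rfl <;> first | rfl | exact absurd h (by decide)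

theorem completeTree_colorable {n : ℕ} (hn : 1 ≤ n)
    (R : (completeTree 2 (n + 2)).Routing) :
    R.conflictGraph.Colorable (5 * (2 ^ (n + 1) - 1) ^ 2 + 4 * (2 ^ (n + 1) - 1)) := by
  -- Here height at least three enters: it makes `t = 2 ^ (n + 1) - 1` at least `3`.
  have h4 : 2 ^ 2 ≤ 2 ^ (n + 1) := Nat.pow_le_pow_right (by norm_num) (by omega)
  refine R.colorable_of_heap (completeTree_isTree 2 _).isAcyclic (by omega)
    (f := fun w => wordLabel w.1) ?_ ?_ ?_ (fun w => w.1.length) ?_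
  · intro x
    have hpre : ∀ a b : Fin 2, ∀ z : Fin 7, 3 ≤ z → (∀ w, wordLabel w = z ↔ [a, b] <+: w) →
        ((fun w : Word 2 (n + 2) => wordLabel w.1) ⁻¹' {z}).ncard ≤
          heapSize (2 ^ (n + 1) - 1) z := by
      intro a b z hz h
      have : (fun w : Word 2 (n + 2) => wordLabel w.1) ⁻¹' {z} = prefixSet [a, b] :=
        Set.ext fun w => h w.1
      rw [this, heapSize, if_neg (by omega)]
      exact (ncard_prefixSet (n := n) [a, b]).le
    by_cases hx : x ≤ 2
    · rw [heapSize, if_pos hx, Set.ncard_le_one]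
      rintro a rfl b hb
      exact Subtype.ext (wordLabel_injOn hb.symm hx)
    · have : x = 3 ∨ x = 4 ∨ x = 5 ∨ x = 6 := by omega
      rcases this with rfl | rfl | rfl | rfl
      · exact hpre 0 0 3 (by decide) fun w => (wordLabel_eq_iff w).1
      · exact hpre 0 1 4 (by decide) fun w => (wordLabel_eq_iff w).2.1
      · exact hpre 1 0 5 (by decide) fun w => (wordLabel_eq_iff w).2.2.1
      · exact hpre 1 1 6 (by decide) fun w => (wordLabel_eq_iff w).2.2.2
  · exact fun u v h hu => Subtype.ext (wordLabel_injOn h hu)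
  · have : ∀ x : Fin 7, ∃ w ∈ ([[], [0], [1], [0, 0], [0, 1], [1, 0], [1, 1]] :
        List (List (Fin 2))), w.length ≤ 2 ∧ wordLabel w = x := by decide
    intro x
    obtain ⟨w, -, hw, hx⟩ := this x
    exact ⟨⟨w, by omega⟩, hx⟩
  · intro v hv
    have hne : v.1 ≠ [] := fun h => hv (by simp only [h]; rfl)
    exact ⟨wordParent v, (completeTree_adj_iff _ _).2 (Or.inr ⟨hne, rfl⟩),
      length_wordParent_lt hne, wordLabel_dropLast v.1 hv⟩

/-- The three sides of the vertex `[0]` have `t`, `t` and `2 * t + 2` vertices, where `t = 2 ^ (n +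
1) - 1`, giving `t ^ 2 + 2 * t * (2 * t + 2)` pairwise conflicting paths. -/
theorem completeTree_le_chromaticNumber (n : ℕ) (R : (completeTree 2 (n + 2)).Routing) :
    (5 * (2 ^ (n + 1) - 1) ^ 2 + 4 * (2 ^ (n + 1) - 1) : ℕ) ≤
      R.conflictGraph.chromaticNumber := by
  let S : Fin 3 → Set (Word 2 (n + 2)) := ![prefixSet [0, 0], prefixSet [0, 1], (prefixSet [0])ᶜ]
  let v : (w : List (Fin 2)) → w.length ≤ 2 → Word 2 (n + 2) := fun w hw => ⟨w, by omega⟩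
  have h01 : ∀ w : Word 2 (n + 2), w ∈ prefixSet [0, 0] → w ∉ prefixSet [0, 1] := by
    rintro ⟨_, _⟩ ⟨l, rfl⟩ ⟨l', h⟩
    simp at h
  have h0 : ∀ i : Fin 2, ∀ w : Word 2 (n + 2), w ∈ prefixSet [0, i] → w ∈ prefixSet [0] := by
    rintro i ⟨_, _⟩ ⟨l, rfl⟩
    exact ⟨i :: l, rfl⟩
  have h := R.le_chromaticNumber_of_three S ?_
    ![s(v [0, 0] (by simp), v [0] (by simp)), s(v [0, 1] (by simp), v [0] (by simp)),
      s(v [] (by simp), v [0] (by simp))] ?_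
  · have c0 : (S 0).ncard = 2 ^ (n + 1) - 1 := ncard_prefixSet (n := n) [0, 0]
    have c1 : (S 1).ncard = 2 ^ (n + 1) - 1 := ncard_prefixSet (n := n) [0, 1]
    have c2 : (S 2).ncard = 2 * (2 ^ (n + 1) - 1) + 2 := by
      have hc := Set.ncard_add_ncard_compl (prefixSet [0] : Set (Word 2 (n + 2)))
      rw [card_word_two] at hc
      have h1 : (prefixSet [0] : Set (Word 2 (n + 2))).ncard = 2 ^ (n + 1 + 1) - 1 :=
        ncard_prefixSet (n := n + 1) [0]
      have h2 : (S 2).ncard = ((prefixSet [0] : Set (Word 2 (n + 2)))ᶜ).ncard := rfl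
      rw [← h2, h1] at hc
      have h3 : 2 ^ (n + 2 + 1) = 4 * 2 ^ (n + 1) := by ring
      have h4 : 2 ^ (n + 1 + 1) = 2 * 2 ^ (n + 1) := by ring
      have h5 : 0 < 2 ^ (n + 1) := by positivity
      omega
    rw [c0, c1, c2] at h
    refine le_trans (le_of_eq ?_) h
    congr 1
    ring
  · intro i j w hi hj
    fin_cases i <;> fin_cases j <;> first | rfl | exfalso
    · exact h01 w hi hj
    · exact hj (h0 0 w hi)
    · exact h01 w hj hi
    · exact hj (h0 1 w hi)
    · exact hi (h0 0 w hj)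
    · exact hi (h0 1 w hj)
  · intro i x hx y hy hxy
    fin_cases i
    · obtain ⟨h1, h2⟩ := completeTree_cut hx hy hxy
      exact congrArg₂ (fun a b => s(a, b)) (Subtype.ext h1) (Subtype.ext h2)
    · obtain ⟨h1, h2⟩ := completeTree_cut hx hy hxy
      exact congrArg₂ (fun a b => s(a, b)) (Subtype.ext h1) (Subtype.ext h2)
    · obtain ⟨h1, h2⟩ := completeTree_cut (Set.notMem_compl_iff.1 hy) hx hxy.symm
      exact congrArg₂ (fun a b => s(a, b)) (Subtype.ext h2) (Subtype.ext h1)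

theorem completeTree_forwardingIndex (n : ℕ) :
    (completeTree 2 (n + 1)).forwardingIndex = ((2 ^ (n + 1) - 1) * 2 ^ (n + 1) : ℕ) := by
  have hV : Nat.card (Word 2 (n + 1)) = 2 * 2 ^ (n + 1) - 1 := by
    rw [card_word_two]; ring_nf
  have hpos : 0 < 2 ^ (n + 1) := by positivity
  have h := (completeTree_isTree 2 (n + 1)).forwardingIndex_eq ⟨[], Nat.zero_le _⟩
    -- The first letter names the branch at the root; the empty word has none.
    (fun w => w.1.head?) (2 ^ (n + 1) - 1) ?_ ?_ ?_ ?_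
    (by rw [show Nat.card {w : List (Fin 2) // w.length ≤ n + 1} = _ from hV]; omega)
  · rw [h, hV]
    congr 2
    omega
  · intro v
    rw [List.head?_eq_none_iff, Subtype.ext_iff]
  · have key : ∀ u v : Word 2 (n + 1), u.1 ≠ [] → (∃ i, v.1 = u.1 ++ [i]) →
        u.1.head? = v.1.head? := by
      rintro u v hu ⟨i, hi⟩
      rw [hi, List.head?_append_of_ne_nil _ hu]
    rintro u v (h | h) hu hv
    · exact key u v (fun h => hu (Subtype.ext h)) h
    · exact (key v u (fun h => hv (Subtype.ext h)) h).symm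
  · intro i
    have : (fun w : Word 2 (n + 1) => w.1.head?) ⁻¹' {some i} = prefixSet [i] := by
      ext ⟨w, hw⟩
      rcases w with _ | ⟨x, l⟩
      · simp [prefixSet]
      · simp [prefixSet, eq_comm]
    rw [this]
    exact ncard_prefixSet (n := n) [i]
  · intro i
    refine ⟨⟨[i], by simp⟩, Or.inl ⟨i, rfl⟩, ?_⟩
    rintro w hw (⟨j, hj⟩ | ⟨j, hj⟩)
    · apply Subtype.ext
      rw [hj] at hw ⊢
      simpa using hw
    · simp at hj

/-! ### The ratios and feasibility -/

theorem completeTree_opticalRatio {h : ℕ} (hh : 3 ≤ h) : (completeTree 2 h).opticalRatio =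
    1 + ((2 : ℚ) ^ (2 * h - 2) - 2 ^ (h + 1) + 1) / (2 ^ (2 * h) - 2 ^ h) := by
  obtain ⟨n, rfl⟩ := Nat.exists_eq_add_of_le' hh
  have hopt := opticalIndex_eq (completeTree_isTree 2 (n + 1 + 2))
    (completeTree_colorable (n := n + 1) (by omega)) (completeTree_le_chromaticNumber (n + 1))
  have hfwd := completeTree_forwardingIndex (n + 2)
  change (completeTree 2 (n + 1 + 2)).opticalRatio = _
  rw [opticalRatio, hopt, ENat.toNat_natCast]
  change _ / ((((completeTree 2 (n + 2 + 1)).forwardingIndex).toNat : ℕ) : ℚ) = _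
  rw [hfwd, ENat.toNat_natCast]
  -- With `m = 2 ^ (h - 1)` the claim reduces to `5 * (m - 1) ^ 2 + 4 * (m - 1) = (4 * m ^ 2 - 2 *
  -- m) + (m ^ 2 - 4 * m + 1)`.
  have e1 : (2 : ℚ) ^ (2 * (n + 3) - 2) = (2 ^ (n + 2)) ^ 2 := by
    rw [← pow_mul]; congr 1; omega
  have e2 : (2 : ℚ) ^ (n + 3 + 1) = 4 * 2 ^ (n + 2) := by ring
  have e3 : (2 : ℚ) ^ (2 * (n + 3)) = 4 * (2 ^ (n + 2)) ^ 2 := by ring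
  have e4 : (2 : ℚ) ^ (n + 3) = 2 * 2 ^ (n + 2) := by ring
  have p1 : 1 ≤ 2 ^ (n + 1 + 1) := Nat.one_le_two_pow
  have p2 : 1 ≤ 2 ^ (n + 2 + 1) := Nat.one_le_two_pow
  push_cast [Nat.cast_sub p1, Nat.cast_sub p2]
  rw [e1, e2, e3, e4, show (2 : ℚ) ^ (n + 1 + 1) = 2 ^ (n + 2) from rfl]
  have hm : (1 : ℚ) ≤ 2 ^ (n + 2) := one_le_pow₀ (by norm_num)
  generalize (2 : ℚ) ^ (n + 2) = m at hm
  have h1 : m ≠ 0 := by linarith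
  have h2 : 2 * m - 1 ≠ 0 := by linarith
  rw [show 4 * m ^ 2 - 2 * m = (2 * m - 1) * (2 * m) by ring]
  have h3 : (2 * m - 1) * (2 * m) ≠ 0 := mul_ne_zero h2 (mul_ne_zero two_ne_zero h1)
  rw [div_eq_iff h3, add_mul, div_mul_cancel₀ _ h3]
  ring

/-- With `m = 2 ^ (h - 3) ≥ 1` the numerator is `16 * m * (m - 1) + 1`. -/
theorem one_le_completeTree_ratio {h : ℕ} (hh : 3 ≤ h) :
    1 ≤ 1 + ((2 : ℚ) ^ (2 * h - 2) - 2 ^ (h + 1) + 1) / (2 ^ (2 * h) - 2 ^ h) := by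
  obtain ⟨n, rfl⟩ := Nat.exists_eq_add_of_le' hh
  have e1 : (2 : ℚ) ^ (2 * (n + 3) - 2) = (4 * 2 ^ n) ^ 2 := by
    rw [show 2 * (n + 3) - 2 = 2 * n + 4 by omega]; ring
  have e2 : (2 : ℚ) ^ (n + 3 + 1) = 16 * 2 ^ n := by ring
  have e3 : (2 : ℚ) ^ (2 * (n + 3)) = 64 * (2 ^ n) ^ 2 := by ring
  have e4 : (2 : ℚ) ^ (n + 3) = 8 * 2 ^ n := by ring
  have hm : (1 : ℚ) ≤ 2 ^ n := one_le_pow₀ (by norm_num)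
  rw [e1, e2, e3, e4]
  generalize (2 : ℚ) ^ n = m at hm
  exact le_add_of_nonneg_right (div_nonneg (by nlinarith) (by nlinarith))

theorem one_le_branch_ratio {k t : ℕ} (hk : 3 ≤ k) (ht : 1 ≤ t) :
    1 ≤ 1 + ((t : ℚ) - 1) / (((k : ℚ) - 1) * t + 1) := by
  have ht0 : (1 : ℚ) ≤ t := by exact_mod_cast ht
  have hk0 : (3 : ℚ) ≤ k := by exact_mod_cast hk
  exact le_add_of_nonneg_right (div_nonneg (by linarith) (by nlinarith))

end SimpleGraph

theorem mainTheorem4 :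
    (∀ h : ℕ, 3 ≤ h →
      (SimpleGraph.completeTree 2 h).opticalRatio =
          1 + ((2 : ℚ) ^ (2 * h - 2) - 2 ^ (h + 1) + 1) / (2 ^ (2 * h) - 2 ^ h) ∧
        SimpleGraph.Feasible
          (1 + ((2 : ℚ) ^ (2 * h - 2) - 2 ^ (h + 1) + 1) / (2 ^ (2 * h) - 2 ^ h))) ∧
    (∀ k t : ℕ, Odd k → 3 ≤ k → 1 ≤ t →
      (∃ (V : Type) (_ : Finite V) (G : SimpleGraph V) (r : V), G.IsGTree r k t) ∧
        (∀ (V : Type*) [Finite V] (G : SimpleGraph V) (r : V), G.IsGTree r k t →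
          G.opticalRatio = 1 + ((t : ℚ) - 1) / (((k : ℚ) - 1) * t + 1)) ∧
        SimpleGraph.Feasible (1 + ((t : ℚ) - 1) / (((k : ℚ) - 1) * t + 1))) ∧
    (∀ k : ℕ, Odd k → 3 ≤ k →
      Filter.Tendsto (fun t : ℕ => 1 + ((t : ℚ) - 1) / (((k : ℚ) - 1) * t + 1))
        Filter.atTop (nhds ((k : ℚ) / ((k : ℚ) - 1)))) := by
  refine ⟨fun h hh => ⟨SimpleGraph.completeTree_opticalRatio hh,
    SimpleGraph.one_le_completeTree_ratio hh, _, inferInstance, ?_, SimpleGraph.completeTree 2 h,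
    (SimpleGraph.completeTree_isTree 2 h).connected, SimpleGraph.completeTree_opticalRatio hh⟩,
    fun k t hk hk3 ht => ?_, fun k _ hk3 => SimpleGraph.tendsto_ratio k hk3⟩
  · exact ⟨⟨[], by simp⟩, ⟨[0], by simp; omega⟩, by simp⟩
  · have : NeZero t := ⟨by omega⟩
    have : NeZero k := ⟨by omega⟩
    have hG := SimpleGraph.starOfStars_isGTree k t
    exact ⟨⟨_, inferInstance, _, _, hG⟩, fun V _ G r h => h.opticalRatio_eq hk hk3 ht,
      SimpleGraph.one_le_branch_ratio hk3 ht, _, inferInstance,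
      ⟨none, some (0, 0), by simp⟩, _, hG.isTree.connected, hG.opticalRatio_eq hk hk3 ht⟩
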